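/- Let $\lambda\ge 2$ be a cardinal (finite or infinite), and let $P_\lambda$ be the $\lambda$-polycyclic monoid, i.e. the monoid with zero given by the presentation $$P_\lambda=\left\langle \{p_i\}_{i\in\lambda},\ \{p_i^{-1}\}_{i\in\lambda}\ \middle|\ p_ip_i^{-1}=1,\ \ p_ip_j^{-1}=0\ \text{ for } i\neq j\right\rangle .$$ Suppose that $P_\lambda$ carries a Hausdorff topology for which its multiplication $P_\lambda\times P_\lambda\to P_\lambda$ is continuous. Then the topological semigroup $P_\lambda$ has a Bohr compactification, and every Bohr compactification of $P_\lambda$ is a trivial (one-element) semigroup. Here a topological semigroup is a Hausdorff space with a continuous associative multiplication, homomorphisms are semigroup homomorphisms, and a Bohr compactification of a topological semigroup $S$ is a pair $(\beta,B)$ where $B$ is a compact topological semigroup and $\beta\colon S\to B$ is a continuous homomorphism such that for every continuous homomorphism $g\colon S\to T$ into a compact topological semigroup $T$ there is a unique continuous homomorphism $f\colon B\to T$ with $f\circ\beta=g$. -/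

import Mathlib

universe u v

/-- The free monoid with zero on the formal symbols `p i` (`Sum.inl i`) and `p i ⁻¹` (`Sum.inr i`),
`i : ι`: all finite words in these symbols (the empty word being the identity), together with an
adjoined zero. -/
abbrev PolycyclicWord (ι : Type u) : Type u := WithZero (FreeMonoid (ι ⊕ ι))

/-- The one-letter word `p i`. -/
def PolycyclicWord.p {ι : Type u} (i : ι) : PolycyclicWord ι :=
  ((FreeMonoid.of (Sum.inl i) : FreeMonoid (ι ⊕ ι)) : WithZero (FreeMonoid (ι ⊕ ι)))

/-- The one-letter word `p i ⁻¹` (a formal symbol). -/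
def PolycyclicWord.pInv {ι : Type u} (i : ι) : PolycyclicWord ι :=
  ((FreeMonoid.of (Sum.inr i) : FreeMonoid (ι ⊕ ι)) : WithZero (FreeMonoid (ι ⊕ ι)))

/-- The defining relations: `p i * (p i)⁻¹ = 1`, and `p i * (p j)⁻¹ = 0` for `i ≠ j`. -/
inductive PolycyclicRel (ι : Type u) : PolycyclicWord ι → PolycyclicWord ι → Prop
  | mul_inv_self (i : ι) : PolycyclicRel ι (PolycyclicWord.p i * PolycyclicWord.pInv i) 1
  | mul_inv_of_ne (i j : ι) (h : i ≠ j) :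
      PolycyclicRel ι (PolycyclicWord.p i * PolycyclicWord.pInv j) 0

/-- The polycyclic monoid on the generators `p i`, `i : ι`: the monoid with zero presented by
`⟨p i, (p i)⁻¹ (i : ι) | p i * (p i)⁻¹ = 1, p i * (p j)⁻¹ = 0 for i ≠ j⟩`, that is, the quotient of
the free monoid with zero by the least congruence containing the defining relations. -/
def PolycyclicMonoid (ι : Type u) : Type u := (conGen (PolycyclicRel ι)).Quotient

instance PolycyclicMonoid.instMonoidWithZero (ι : Type u) : MonoidWithZero (PolycyclicMonoid ι) :=
  { (inferInstance : Monoid (conGen (PolycyclicRel ι)).Quotient) with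
    zero := ((0 : PolycyclicWord ι) : (conGen (PolycyclicRel ι)).Quotient)
    zero_mul := fun a => Con.induction_on a fun x =>
      congrArg ((↑) : PolycyclicWord ι → (conGen (PolycyclicRel ι)).Quotient) (zero_mul x)
    mul_zero := fun a => Con.induction_on a fun x =>
      congrArg ((↑) : PolycyclicWord ι → (conGen (PolycyclicRel ι)).Quotient) (mul_zero x) }

/-- `β : S → B` is a Bohr compactification of the topological semigroup `S`: `B` is a compact
(Hausdorff) topological semigroup, `β` is a continuous homomorphism, and every continuous
homomorphism `g` from `S` to a compact (Hausdorff) topological semigroup `T` factors as `f ∘ β` for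
a unique continuous homomorphism `f : B → T`. Homomorphisms are semigroup homomorphisms. -/
structure IsBohrCompactification {S : Type u} [Semigroup S] [TopologicalSpace S]
    {B : Type v} [Semigroup B] [TopologicalSpace B] (β : S →ₙ* B) : Prop where
  compactSpace : CompactSpace B
  t2Space : T2Space B
  continuousMul : ContinuousMul B
  continuous : Continuous β
  existsUnique_lift : ∀ (T : Type (max u v)) [Semigroup T] [TopologicalSpace T] [CompactSpace T]
    [T2Space T] [ContinuousMul T] (g : S →ₙ* T), Continuous g →
      ∃! f : B →ₙ* T, Continuous f ∧ f.comp β = g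

/-!
The reason for the triviality is that a compact Hausdorff topological semigroup contains no bicyclic
monoid: if `a * b = e`, where `e` acts as an identity on `a` and `b`, then `b * a = e`
(`mul_eq_of_mul_eq_of_compact`). Indeed the right invertible elements of `T * a` form a compact
subsemigroup, which contains an idempotent; a right invertible idempotent is `e`, so `e` lies in
`T * a`, and `a` is also left invertible.

Let `g` be a homomorphism from the polycyclic monoid to such a semigroup, and let `i ≠ j`. Then
`g (p i)⁻¹ * g (p i) = g 1 = g (p j)⁻¹ * g (p j)`. In the product of these two expressions the inner
factor `g (p i) * g (p j)⁻¹` is `g 0`, so `g 1 = g 0` and `g` is constant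
(`PolycyclicMonoid.map_eq_map_zero`). Continuity of `g` plays no role. Hence the one-point semigroup
is a Bohr compactification, and in an arbitrary one, `(β, B)`, the identity of `B` and the constant
map to `β 0` are both lifts of `β`, so they coincide.
-/

/-- Compact Hausdorff topological semigroups contain no bicyclic monoid: if `e` acts as an identity
on `a` and `b`, a one-sided inverse relation `a * b = e` is two-sided. -/
theorem mul_eq_of_mul_eq_of_compact {T : Type*} [Semigroup T] [TopologicalSpace T] [CompactSpace T]
    [T2Space T] [ContinuousMul T] {a b e : T} (hab : a * b = e) (hea : e * a = a) (hae : a * e = a)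
    (heb : e * b = b) : b * a = e := by
  let s : Set T := Set.range (fun c : T => c * a) ∩ Prod.fst '' {q : T × T | q.1 * q.2 = e}
  have hs : IsCompact s := by
    refine (isCompact_range (by fun_prop)).inter (IsCompact.image ?_ continuous_fst)
    exact (isClosed_eq (by fun_prop) (by fun_prop)).isCompact
  have has : a ∈ s := ⟨⟨e, hea⟩, (a, b), hab, rfl⟩
  have hmul : ∀ x ∈ s, ∀ y ∈ s, x * y ∈ s := by
    rintro _ ⟨⟨c, rfl⟩, ⟨_, x'⟩, hx, rfl⟩ _ ⟨⟨d, rfl⟩, ⟨_, y'⟩, hy, rfl⟩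
    refine ⟨⟨c * a * d, by simp only [mul_assoc]⟩, (_, y' * x'), ?_, rfl⟩
    simp only [Set.mem_ofPred_eq] at hx hy ⊢
    calc c * a * (d * a) * (y' * x') = c * a * (d * a * y') * x' := by simp only [mul_assoc]
      _ = c * (a * e) * x' := by rw [hy, mul_assoc c]
      _ = e := by rw [hae, hx]
  obtain ⟨_, ⟨⟨c, hc⟩, ⟨f, y⟩, hy, rfl⟩, hff⟩ :=
    exists_idempotent_in_compact_subsemigroup (fun r : T => continuous_mul_const r) s ⟨a, has⟩ hs
      hmul
  simp only [Set.mem_ofPred_eq] at hy hc hff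
  have hfe : f = e := by
    calc f = f * e := by rw [← hc, mul_assoc, hae]
      _ = f * f * y := by rw [mul_assoc, hy]
      _ = e := by rw [hff, hy]
  have hca : c * a = e := hc.trans hfe
  calc b * a = c * a * b * a := by rw [hca, heb]
    _ = c * (a * b * a) := by simp only [mul_assoc]
    _ = e := by rw [hab, hea, hca]

namespace PolycyclicMonoid

variable {ι : Type u}

/-- The generator `p i` of the polycyclic monoid. -/
def p (i : ι) : PolycyclicMonoid ι :=
  ((PolycyclicWord.p i : PolycyclicWord ι) : (conGen (PolycyclicRel ι)).Quotient)

/-- The generator `(p i)⁻¹` of the polycyclic monoid. -/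
def pInv (i : ι) : PolycyclicMonoid ι :=
  ((PolycyclicWord.pInv i : PolycyclicWord ι) : (conGen (PolycyclicRel ι)).Quotient)

theorem p_mul_pInv_self (i : ι) : p i * pInv i = 1 :=
  ((conGen (PolycyclicRel ι)).eq).2 (ConGen.Rel.of _ _ (.mul_inv_self i))

theorem p_mul_pInv_of_ne {i j : ι} (h : i ≠ j) : p i * pInv j = 0 :=
  ((conGen (PolycyclicRel ι)).eq).2 (ConGen.Rel.of _ _ (.mul_inv_of_ne i j h))

/-- Every homomorphism, continuous or not, from a polycyclic monoid on at least two generators to a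
compact Hausdorff topological semigroup is constant. -/
theorem map_eq_map_zero [Nontrivial ι] {T : Type*} [Semigroup T] [TopologicalSpace T]
    [CompactSpace T] [T2Space T] [ContinuousMul T] (g : PolycyclicMonoid ι →ₙ* T)
    (x : PolycyclicMonoid ι) : g x = g 0 := by
  have inv_mul (i : ι) : g (pInv i) * g (p i) = g 1 := by
    apply mul_eq_of_mul_eq_of_compact <;> simp only [← map_mul, p_mul_pInv_self, one_mul, mul_one]
  obtain ⟨i, j, hij⟩ := exists_pair_ne ι
  have h10 : g 1 = g 0 := by
    calc g 1 = g (pInv i) * g (p i) * (g (pInv j) * g (p j)) := by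
          rw [inv_mul, inv_mul, ← map_mul, one_mul]
      _ = g (pInv i * (p i * pInv j) * p j) := by simp only [map_mul, mul_assoc]
      _ = g 0 := by rw [p_mul_pInv_of_ne hij, mul_zero, zero_mul]
  calc g x = g 1 * g x := by rw [← map_mul, one_mul]
    _ = g 0 := by rw [h10, ← map_mul, zero_mul]

end PolycyclicMonoid

/-- The constant semigroup homomorphism with value an idempotent `e`. -/
def MulHom.constOfIdempotent (M : Type*) {N : Type*} [Mul M] [Mul N] (e : N) (he : e * e = e) :
    M →ₙ* N where
  toFun _ := e
  map_mul' _ _ := he.symm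

theorem corollary4p3 (ι : Type u) (hι : 2 ≤ Cardinal.mk ι)
    [TopologicalSpace (PolycyclicMonoid ι)] [T2Space (PolycyclicMonoid ι)]
    [ContinuousMul (PolycyclicMonoid ι)] :
    (∃ (B : Type v) (_ : Semigroup B) (_ : TopologicalSpace B) (β : PolycyclicMonoid ι →ₙ* B),
      IsBohrCompactification β) ∧
    ∀ (B : Type v) [Semigroup B] [TopologicalSpace B] (β : PolycyclicMonoid ι →ₙ* B),
      IsBohrCompactification β → Nonempty B ∧ Subsingleton B := by
  have : Nontrivial ι := Cardinal.one_lt_iff_nontrivial.1 (Cardinal.one_lt_two.trans_le hι)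
  refine ⟨⟨PUnit, inferInstance, inferInstance, MulHom.constOfIdempotent _ PUnit.unit rfl,
    ⟨inferInstance, inferInstance, inferInstance, continuous_const, ?_⟩⟩, ?_⟩
  · intro T _ _ _ _ _ g _
    refine ⟨MulHom.constOfIdempotent _ (g 0) (by rw [← map_mul, zero_mul]), ⟨continuous_const, ?_⟩, ?_⟩
    · ext x
      exact (PolycyclicMonoid.map_eq_map_zero g x).symm
    · rintro f ⟨-, rfl⟩
      rfl
  · intro B _ _ β hβ
    have := hβ.compactSpace
    have := hβ.t2Space
    have := hβ.continuousMul
    -- `B` has to be raised to the universe of the test semigroups.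
    let up : B →ₙ* ULift.{u} B := ⟨ULift.up, fun _ _ => rfl⟩
    have hup : Continuous up := continuous_uliftUp
    have : ContinuousMul (ULift.{u} B) :=
      ⟨hup.comp ((continuous_uliftDown.comp continuous_fst).mul
        (continuous_uliftDown.comp continuous_snd))⟩
    let g := up.comp β
    have heq : up = MulHom.constOfIdempotent B (g 0) (by rw [← map_mul, zero_mul]) := by
      refine (hβ.existsUnique_lift (ULift.{u} B) g (hup.comp hβ.continuous)).unique
        ⟨hup, rfl⟩ ⟨continuous_const, ?_⟩
      ext x
      exact congrArg ULift.down (PolycyclicMonoid.map_eq_map_zero g x).symm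
    refine ⟨⟨β 0⟩, ⟨fun x y => ?_⟩⟩
    exact congrArg ULift.down ((DFunLike.congr_fun heq x).trans (DFunLike.congr_fun heq y).symm)
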